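/- Let $G=(V,E)$ be a finite graph (parallel edges and loops allowed). For $v\in V$ let $H(v)=\{(v,e):e\ni v\}$ be the set of half-edges at $v$, a loop at $v$ contributing two half-edges, and let $G$ be $k$-regular, i.e. $|H(v)|=k$ for all $v$, where $k\ge 0$ is any integer (odd or even). For a map $\beta:X\to Y$ between finite linearly ordered sets put $\mathrm{sgn}(\beta)=(-1)^{\#\{(\ell,m)\in X^2:\ \ell<m,\ \beta(\ell)>\beta(m)\}}$ if $\beta$ is injective and $\mathrm{sgn}(\beta)=0$ otherwise. Number the vertices of $G$, that is, fix a linear order on $V$. The sign $\mathrm{sgn}(M)$ of a perfect matching $M=\{u_1v_1,\dots,u_nv_n\}$ with $u_i<v_i$ is the sign of the arrangement $u_1,v_1,u_2,v_2,\dots,u_n,v_n$ of $V$ (it does not depend on the order in which the edges of $M$ are listed). A Pfaffian labelling of $G$ is a map $l:E\to\Gamma$ to an abelian group $\Gamma$ with a chosen element of order two, written $-1$, such that $\prod_{e\in M}l(e)=\mathrm{sgn}(M)$ in $\Gamma$ for every perfect matching $M$ of $G$. Suppose that $G$ admits a Pfaffian labelling (for some $\Gamma$, some element of order two and some numbering of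 $V$). Let $L(G)$ be the line graph of $G$: its vertices are the edges of $G$, two different edges being adjacent when they share an end; a loop of $G$ is a loop of $L(G)$. Let $P(L(G);k)$ be the number of proper vertex $k$-colourings of $L(G)$, i.e. of proper edge $k$-colourings of $G$ (so it is $0$ if $G$ has a loop). Choose a linear order on $H(v)$ for each $v\in V$, and for an edge colouring $y\in\mathbb{Z}_{k+1}^E$ put $$\mathrm{sgn}(y)=\prod_{v\in V}\mathrm{sgn}\big(H(v)\to\{0<1<\cdots<k\},\ (v,e)\mapsto y_e\big),$$ which is $0$ if two half-edges at some vertex have the same colour. Then $$\pm P(L(G);k)=(k+1)^{-|V|/2}\sum_{y\in\mathbb{Z}_{k+1}^E}\mathrm{sgn}(y).$$ The sign on the left-hand side can be chosen, as a function of the system of orders on the sets $H(v)$, so that it depends only on the orders up to even permutation: it is the same for two systems of orders that differ altogether by an even permutation, and opposite for two that differ by an odd permutation. -/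

import Mathlib

open scoped Graph

universe u v w

/-- The sign of a map `b : X → Y` between linearly ordered finite sets: `(-1)` to the number of
inversions if `b` is injective, and `0` otherwise. -/
noncomputable def mapSign {X Y : Type*} (lX : LinearOrder X) (lY : LinearOrder Y) (b : X → Y) : ℤ :=
  open Classical in
  if Function.Injective b then
    (-1) ^ Nat.card {p : X × X // lX.lt p.1 p.2 ∧ lY.lt (b p.2) (b p.1)}
  else 0

namespace Graph

variable {α β : Type*}

/-- The set `H(v)` of half-edges of `G` at the vertex `v`: one half-edge for every edge incident
with `v`, and one further copy for every loop at `v`. -/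
def HalfEdgesAt (G : Graph α β) (v : V(G)) : Type _ :=
  {e : E(G) // G.Inc e v} ⊕ {e : E(G) // G.IsLoopAt e v}

/-- The edge to which a half-edge belongs. -/
def HalfEdgesAt.edge {G : Graph α β} {v : V(G)} (h : G.HalfEdgesAt v) : E(G) :=
  Sum.elim Subtype.val Subtype.val h

/-- Every vertex has degree `k` (loops count twice). -/
def IsRegularGraph (G : Graph α β) (k : ℕ) : Prop :=
  ∀ v : V(G), Nat.card (G.HalfEdgesAt v) = k

/-- A system of linear orders, one on each set `H(v)` of half-edges. -/
abbrev HalfEdgeOrders (G : Graph α β) : Type _ :=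
  ∀ v : V(G), LinearOrder (G.HalfEdgesAt v)

/-- Adjacency in the line graph `L(G)`, whose vertices are the edges of `G`: two different edges
are adjacent if they have a common end, and `L(G)` has a loop at each loop of `G`. -/
def LineAdj (G : Graph α β) (e f : E(G)) : Prop :=
  (e ≠ f ∧ ∃ v : V(G), G.Inc e v ∧ G.Inc f v) ∨ (e = f ∧ ∃ v : V(G), G.IsLoopAt e v)

/-- `P(L(G); k)`, the number of proper vertex `k`-colourings of the line graph `L(G)`,
i.e. of proper edge `k`-colourings of `G`. -/
noncomputable def numProperEdgeColourings (G : Graph α β) (k : ℕ) : ℕ :=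
  Nat.card {c : E(G) → Fin k // ∀ e f, G.LineAdj e f → c e ≠ c f}

/-- The sign `sgn(y)` of an edge colouring `y` with the colours `0 < 1 < ⋯ < q - 1`: the product
over the vertices `v` of the sign of `H(v) → {0, …, q - 1}`, `(v, e) ↦ y e`. -/
noncomputable def colouringSign (G : Graph α β) [Fintype V(G)] (o : G.HalfEdgeOrders) {q : ℕ}
    (y : E(G) → Fin q) : ℤ :=
  ∏ v : V(G), mapSign (o v) inferInstance (fun h => y h.edge)

/-- The total sign by which two systems of linear orders on the sets `H(v)` differ: `1` if they
differ altogether by an even permutation, `-1` if by an odd one. -/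
noncomputable def ordersSign (G : Graph α β) [Fintype V(G)] (o o' : G.HalfEdgeOrders) : ℤ :=
  ∏ v : V(G), mapSign (o v) (o' v) id

/-- A perfect matching `{u₁v₁, …, uₙvₙ}` of `G`, with its edges listed in some order, and each
edge written with its smaller end first. -/
structure PerfectMatching (G : Graph α β) (lV : LinearOrder V(G)) (n : ℕ) where
  edge : Fin n → E(G)
  fst : Fin n → V(G)
  snd : Fin n → V(G)
  isLink : ∀ i, G.IsLink (edge i) (fst i) (snd i)
  lt : ∀ i, lV.lt (fst i) (snd i)
  covers : ∀ w : V(G), ∃! i, w = fst i ∨ w = snd i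

/-- The sign of a perfect matching: the sign of the arrangement `u₁, v₁, u₂, v₂, …, uₙ, vₙ` of the
vertices. It does not depend on the order in which the edges are listed. -/
noncomputable def PerfectMatching.sign {G : Graph α β} {lV : LinearOrder V(G)} {n : ℕ}
    (M : G.PerfectMatching lV n) : ℤ :=
  mapSign (X := Fin n ×ₗ Fin 2) inferInstance lV
    (fun p => ![M.fst (ofLex p).1, M.snd (ofLex p).1] (ofLex p).2)

/-- `l : E(G) → Γ` is a Pfaffian labelling of `G` with respect to the element `negOne` of order two
and a linear order (numbering) of the vertices: for every perfect matching `M` the product of the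
labels of its edges is the sign of `M`, read in `Γ`. -/
def IsPfaffianLabelling (G : Graph α β) (lV : LinearOrder V(G)) {Γ : Type*} [CommGroup Γ]
    (negOne : Γ) (l : E(G) → Γ) : Prop :=
  ∀ (n : ℕ) (M : G.PerfectMatching lV n),
    ∏ i, l (M.edge i) = if M.sign = 1 then 1 else negOne

/-- `G` admits a Pfaffian labelling, by the elements of some abelian group `Γ` with an element
of order two. -/
def AdmitsPfaffianLabelling {α : Type u} {β : Type v} (G : Graph α β) : Prop :=
  ∃ (Γ : Type w) (_ : CommGroup Γ) (negOne : Γ) (lV : LinearOrder V(G)) (l : E(G) → Γ),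
    orderOf negOne = 2 ∧ G.IsPfaffianLabelling lV negOne l

end Graph

/-! The signed sum over `k + 1` colours is a tensor network: each vertex carries the sign tensor,
and each edge equates the colours of its two halves. The sign of a map `c` from `k` half-edges to `k
+ 1` colours is the determinant with rows `altVec k, e_{c 0}, e_{c 1}, …` (`det_unitRows_altVec`).
Contraction along edges is invariant under orthogonal changes of basis (`sum_prod_transform_eq`), so
one may apply a reflection taking `altVec k` to `-√(k+1) • e₀`. The vertex tensor becomes `±√(k+1)`
times the sign restricted to maps avoiding colour `0`. This turns the sum into `±√(k+1)^|V|` times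
the signed sum over `k` colours (`exists_sum_prod_mapSign_eq`), for any `k`-regular graph.

The Pfaffian labelling then makes all proper `k`-colourings have one common sign
(`IsPfaffianLabelling.colouringSign_eq`). Their colour classes are perfect matchings partitioning
the edges, so the product of the matching signs is read off from the product of all labels. The
vertex signs of two colourings differ exactly as these products do
(`prod_sign_vertex_eq_prod_sign_colour`). -/

/-! ### Signs of maps between linear orders -/

section MapSign

variable {X X' Y Z : Type*}

theorem mapSign_of_not_injective (lX : LinearOrder X) (lY : LinearOrder Y) {b : X → Y}
    (hb : ¬ Function.Injective b) : mapSign lX lY b = 0 := by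
  rw [mapSign, if_neg hb]

theorem mapSign_comp_equiv (lX : LinearOrder X) (lX' : LinearOrder X') (lY : LinearOrder Y)
    (e : X ≃ X') (he : ∀ a b, lX.lt a b ↔ lX'.lt (e a) (e b)) (b : X' → Y) :
    mapSign lX lY (b ∘ e) = mapSign lX' lY b := by
  unfold mapSign
  have h1 : Function.Injective (b ∘ e) ↔ Function.Injective b := by
    rw [Function.Injective.of_comp_iff' _ e.bijective]
  have h2 : Nat.card {p : X × X // lX.lt p.1 p.2 ∧ lY.lt ((b ∘ e) p.2) ((b ∘ e) p.1)} =
      Nat.card {p : X' × X' // lX'.lt p.1 p.2 ∧ lY.lt (b p.2) (b p.1)} := by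
    refine Nat.card_congr ((Equiv.prodCongr e e).subtypeEquiv ?_)
    rintro ⟨x, x'⟩
    simp [he]
  by_cases h : Function.Injective b
  · rw [if_pos h, if_pos (h1.2 h), h2]
  · rw [if_neg h, if_neg (mt h1.1 h)]

theorem mapSign_embedding_comp (lX : LinearOrder X) (lY : LinearOrder Y) (lZ : LinearOrder Z)
    (j : Y → Z) (hinj : Function.Injective j) (hj : ∀ a b, lZ.lt (j a) (j b) ↔ lY.lt a b)
    (b : X → Y) : mapSign lX lZ (j ∘ b) = mapSign lX lY b := by
  unfold mapSign
  by_cases h : Function.Injective b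
  · rw [if_pos h, if_pos (hinj.comp h)]
    simp only [Function.comp_apply, hj]
  · rw [if_neg h, if_neg (mt Function.Injective.of_comp h)]

theorem mapSign_perm_fin {n : ℕ} (σ : Equiv.Perm (Fin n)) :
    mapSign inferInstance inferInstance σ = (Equiv.Perm.sign σ : ℤ) := by
  classical
  unfold mapSign
  rw [if_pos σ.injective, Equiv.Perm.sign_eq_prod_prod_Ioi, Finset.prod_sigma',
    Finset.prod_ite, Finset.prod_const_one, one_mul, Finset.prod_const]
  push_cast
  congr 1
  rw [Nat.card_eq_fintype_card, Fintype.card_subtype]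
  refine Finset.card_bij' (fun p _ => ⟨p.1, p.2⟩) (fun p _ => (p.1, p.2)) ?_ ?_ ?_ ?_
  · rintro ⟨a, b⟩ h
    have h : a < b ∧ σ b < σ a := by simpa using h
    simp [h.1, h.2.le]
  · rintro ⟨a, b⟩ h
    have h : a < b ∧ σ b ≤ σ a := by simpa using h
    have h' : σ b < σ a := lt_of_le_of_ne h.2 fun e => h.1.ne' (σ.injective e)
    simpa using ⟨h.1, h'⟩
  · intros; rfl
  · intros; rfl

/-- An increasing enumeration of a finite linear order. -/
theorem exists_equiv_fin_lt_iff [Finite X] (lX : LinearOrder X) {n : ℕ} (hn : Nat.card X = n) :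
    ∃ e : X ≃ Fin n, ∀ a b, lX.lt a b ↔ e a < e b := by
  have := Fintype.ofFinite X
  have e := Fintype.orderIsoFinOfCardEq X (k := n) (by rw [← hn, Nat.card_eq_fintype_card])
  exact ⟨e.symm.toEquiv, fun a b => (e.symm.lt_iff_lt (x := a) (y := b)).symm⟩

theorem mapSign_eq_sign_conj (lX : LinearOrder X) (lY : LinearOrder Y) {n : ℕ} (eX : X ≃ Fin n)
    (hX : ∀ a b, lX.lt a b ↔ eX a < eX b) (eY : Y ≃ Fin n)
    (hY : ∀ a b, lY.lt a b ↔ eY a < eY b) (f : X ≃ Y) :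
    mapSign lX lY f = (Equiv.Perm.sign ((eX.symm.trans f).trans eY) : ℤ) := by
  rw [← mapSign_perm_fin, ← mapSign_comp_equiv lX _ _ eX hX,
    ← mapSign_embedding_comp lX lY _ eY eY.injective (fun a b => (hY a b).symm)]
  congr 1
  ext x
  simp

theorem mapSign_trans [Finite X] (lX : LinearOrder X) (lY : LinearOrder Y) (lZ : LinearOrder Z)
    (f : X ≃ Y) (g : Y ≃ Z) :
    mapSign lX lZ (g ∘ f) = mapSign lX lY f * mapSign lY lZ g := by
  have := Finite.of_equiv X f
  have := Finite.of_equiv Y g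
  obtain ⟨eX, hX⟩ := exists_equiv_fin_lt_iff lX rfl
  obtain ⟨eY, hY⟩ := exists_equiv_fin_lt_iff lY (Nat.card_congr f).symm
  obtain ⟨eZ, hZ⟩ := exists_equiv_fin_lt_iff lZ (Nat.card_congr (f.trans g)).symm
  rw [mapSign_eq_sign_conj lX lY eX hX eY hY f, mapSign_eq_sign_conj lY lZ eY hY eZ hZ g,
    ← Equiv.coe_trans, mapSign_eq_sign_conj lX lZ eX hX eZ hZ (f.trans g)]
  norm_cast
  rw [mul_comm, ← Equiv.Perm.sign_mul]
  congr 1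
  ext x
  simp

theorem mapSign_perm [Fintype X] [DecidableEq X] (lX : LinearOrder X) (σ : Equiv.Perm X) :
    mapSign lX lX σ = (Equiv.Perm.sign σ : ℤ) := by
  obtain ⟨e, he⟩ := exists_equiv_fin_lt_iff lX rfl
  rw [mapSign_eq_sign_conj lX lX e he e he, Equiv.Perm.sign_symm_trans_trans]

/-- The ratio of two signs does not involve either order. This is what allows signs at vertices to
be compared with signs of matchings. -/
theorem mapSign_eq_mul_sign [Fintype Y] [DecidableEq Y] (lX : LinearOrder X) (lY : LinearOrder Y)
    (f g : X ≃ Y) :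
    mapSign lX lY g = mapSign lX lY f * (Equiv.Perm.sign (f.symm.trans g) : ℤ) := by
  have := Finite.of_equiv Y f.symm
  rw [← mapSign_perm lY, ← mapSign_trans]
  congr 1
  ext x
  simp

theorem exists_units_mapSign_eq [Finite X] (lX : LinearOrder X) (lY : LinearOrder Y) (f : X ≃ Y) :
    ∃ s : ℤˣ, mapSign lX lY f = s := by
  have := Finite.of_equiv X f
  obtain ⟨eX, hX⟩ := exists_equiv_fin_lt_iff lX rfl
  obtain ⟨eY, hY⟩ := exists_equiv_fin_lt_iff lY (Nat.card_congr f).symm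
  exact ⟨_, mapSign_eq_sign_conj lX lY eX hX eY hY f⟩

end MapSign

/-! ### The sign tensor as a determinant, and its reflection -/

section Det

open Matrix

variable {k : ℕ}

theorem det_indicator {n : ℕ} (b : Fin n → Fin n) :
    (Matrix.of fun i j => if b i = j then (1 : ℝ) else 0).det =
      (mapSign inferInstance inferInstance b : ℤ) := by
  by_cases hb : Function.Injective b
  · obtain ⟨σ, rfl⟩ : ∃ σ : Equiv.Perm (Fin n), ⇑σ = b :=
      ⟨Equiv.ofBijective b (Finite.injective_iff_bijective.1 hb), rfl⟩
    rw [mapSign_perm_fin, ← Matrix.det_permutation (R := ℝ) σ]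
    congr 1
    ext i j
    simp [Equiv.Perm.permMatrix, PEquiv.toMatrix_apply, eq_comm]
  · rw [mapSign_of_not_injective _ _ hb]
    simp only [Function.Injective, not_forall] at hb
    obtain ⟨i, j, hij, hne⟩ := hb
    rw [Int.cast_zero]
    exact Matrix.det_zero_of_row_eq hne (by ext l; simp [hij])

/-- The minor belonging to the column `j` of the matrix whose rows are the unit vectors listed
by `c` is the sign of `c` if `c` avoids `j`, and `0` otherwise. -/
theorem det_indicator_succAbove (c : Fin k → Fin (k + 1)) (j : Fin (k + 1)) :
    (Matrix.of fun i l => if c i = j.succAbove l then (1 : ℝ) else 0).det =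
      if ∀ i, c i ≠ j then ((mapSign inferInstance inferInstance c : ℤ) : ℝ) else 0 := by
  split_ifs with h
  · choose τ hτ using fun i => Fin.exists_succAbove_eq (h i)
    obtain rfl : j.succAbove ∘ τ = c := funext hτ
    rw [mapSign_embedding_comp _ inferInstance _ _ Fin.succAbove_right_injective
      (fun a b => Fin.succAbove_lt_succAbove_iff), ← det_indicator]
    simp
  · push Not at h
    obtain ⟨i, rfl⟩ := h
    exact Matrix.det_eq_zero_of_row_eq_zero i fun l => by simp [(Fin.succAbove_ne _ _).symm]

/-- The matrix with first row `x`, whose further rows are the unit vectors listed by `c`. -/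
def unitRows (x : Fin (k + 1) → ℝ) (c : Fin k → Fin (k + 1)) :
    Matrix (Fin (k + 1)) (Fin (k + 1)) ℝ :=
  Matrix.of (Fin.cons x fun i => Pi.single (c i) 1)

theorem det_unitRows (x : Fin (k + 1) → ℝ) (c : Fin k → Fin (k + 1)) :
    (unitRows x c).det = ∑ j : Fin (k + 1), (-1) ^ (j : ℕ) * x j *
      if ∀ i, c i ≠ j then ((mapSign inferInstance inferInstance c : ℤ) : ℝ) else 0 := by
  rw [Matrix.det_succ_row_zero]
  refine Finset.sum_congr rfl fun j _ => ?_
  rw [← det_indicator_succAbove]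
  congr 2
  ext i l
  simp [unitRows, Pi.single_apply, eq_comm]

/-- The vector `(1, -1, 1, -1, …)`. -/
def altVec (k : ℕ) : Fin (k + 1) → ℝ := fun j => (-1) ^ (j : ℕ)

/-- The alternating entries cancel the cofactor signs of the expansion along the first row, and an
injective `c` misses exactly one colour, so exactly one minor survives. -/
theorem det_unitRows_altVec (c : Fin k → Fin (k + 1)) :
    (unitRows (altVec k) c).det = (mapSign inferInstance inferInstance c : ℤ) := by
  rw [det_unitRows]
  have h1 (j : Fin (k + 1)) : (-1 : ℝ) ^ (j : ℕ) * altVec k j = 1 := by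
    rw [altVec, ← mul_pow]; simp
  simp only [h1, one_mul]
  by_cases hc : Function.Injective c
  · have hcard : (Finset.univ.image c)ᶜ.card = 1 := by
      rw [Finset.card_compl, Finset.card_image_of_injective _ hc]; simp
    obtain ⟨j, hj⟩ := Finset.card_eq_one.1 hcard
    have h2 (l : Fin (k + 1)) : (∀ i, c i ≠ l) ↔ l = j := by
      rw [← Finset.mem_singleton, ← hj]; simp
    simp [h2]
  · simp [mapSign_of_not_injective _ _ hc]

theorem det_unitRows_smul_single_zero (t : ℝ) (c : Fin k → Fin (k + 1)) :
    (unitRows (t • Pi.single 0 1) c).det =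
      t * if ∀ i, c i ≠ 0 then ((mapSign inferInstance inferInstance c : ℤ) : ℝ) else 0 := by
  rw [det_unitRows, Finset.sum_eq_single 0]
  · simp
  · intro j _ hj; simp [hj]
  · simp

theorem unitRows_mul (x : Fin (k + 1) → ℝ) (c : Fin k → Fin (k + 1))
    (U : Matrix (Fin (k + 1)) (Fin (k + 1)) ℝ) :
    unitRows x c * U = Matrix.of (Fin.cons (x ᵥ* U) fun i => U (c i)) := by
  ext i j
  refine Fin.cases ?_ (fun i => ?_) i
  · simp [unitRows, Matrix.mul_apply, Matrix.vecMul, dotProduct]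
  · simp [unitRows, Matrix.mul_apply, Pi.single_apply]

/-- Transformation of the tensor `c ↦ det (x, e_{c 0}, e_{c 1}, …)` by an orthogonal symmetric
matrix. -/
theorem sum_prod_mul_det_unitRows (x : Fin (k + 1) → ℝ) (c : Fin k → Fin (k + 1))
    (U : Matrix (Fin (k + 1)) (Fin (k + 1)) ℝ) (hU : U * U = 1) :
    ∑ d : Fin k → Fin (k + 1), (∏ i, U (c i) (d i)) * (unitRows x d).det =
      U.det * (unitRows (x ᵥ* U) c).det := by
  let f := (Matrix.detRowAlternating (n := Fin (k + 1)) (R := ℝ)).toMultilinearMap.curryLeft x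
  have hf (m : Fin k → Fin (k + 1) → ℝ) : f m = (Matrix.of (Fin.cons x m)).det := rfl
  have h1 (d : Fin k → Fin (k + 1)) : (∏ i, U (c i) (d i)) * (unitRows x d).det =
      f fun i => U (c i) (d i) • (Pi.single (d i) 1 : Fin (k + 1) → ℝ) := by
    rw [f.map_smul_univ]; rfl
  simp only [h1]
  -- Multilinearity collapses the sum to the determinant with rows `x` and `U (c i)`. Since `x = (x
  -- ᵥ* U) ᵥ* U`, this matrix is `unitRows (x ᵥ* U) c * U`.
  rw [← f.map_sum (g := fun i j => U (c i) j • (Pi.single j 1 : Fin (k + 1) → ℝ)), hf,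
    mul_comm, ← Matrix.det_mul, unitRows_mul, Matrix.vecMul_vecMul, hU, Matrix.vecMul_one]
  congr 3
  ext i j
  simp [Finset.sum_apply, Pi.single_apply]

/-- There is a reflection that maps the alternating vector to a multiple of the first unit
vector. -/
theorem exists_reflection_altVec (k : ℕ) :
    ∃ U : Matrix (Fin (k + 1)) (Fin (k + 1)) ℝ, U * U = 1 ∧ Uᵀ = U ∧
      altVec k ᵥ* U = (-√((k : ℝ) + 1)) • Pi.single 0 1 := by
  set s : ℝ := √((k : ℝ) + 1) with hs
  have hs2 : s * s = k + 1 := Real.mul_self_sqrt (by positivity)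
  have hs0 : 0 < s := Real.sqrt_pos.2 (by positivity)
  -- Householder vector: the difference of `altVec k` and `-s • e₀`, which have equal length `s`.
  -- The target `+s • e₀` would give `u = 0` when `k = 0`. The coefficient `(s * s + s)⁻¹` below is
  -- `2 / (u ⬝ᵥ u)`.
  let u : Fin (k + 1) → ℝ := altVec k + s • Pi.single 0 1
  have hww : altVec k ⬝ᵥ altVec k = s * s := by
    have (j : Fin (k + 1)) : altVec k j * altVec k j = 1 := by rw [altVec, ← mul_pow]; simp
    simp [dotProduct, this, hs2]
  have hw0 : altVec k 0 = 1 := by simp [altVec]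
  have hwu : altVec k ⬝ᵥ u = s * s + s := by
    simp [u, dotProduct_add, hww, hw0]
  have huu : u ⬝ᵥ u = 2 * (s * s + s) := by
    simp [u, dotProduct_add, add_dotProduct, hww, hw0]; ring
  have hN : s * s + s ≠ 0 := by positivity
  refine ⟨1 - (s * s + s)⁻¹ • vecMulVec u u, ?_, ?_, ?_⟩
  · have : vecMulVec u u * vecMulVec u u = (2 * (s * s + s)) • vecMulVec u u := by
      rw [vecMulVec_mul_vecMulVec, huu]
      ext i j
      simp [vecMulVec_apply]; ring
    rw [sub_mul, mul_sub, mul_sub, smul_mul_smul_comm, this, smul_smul]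
    have h3 : (s * s + s)⁻¹ * (s * s + s)⁻¹ * (2 * (s * s + s)) = (s * s + s)⁻¹ + (s * s + s)⁻¹ := by
      field_simp; ring
    rw [h3, add_smul]
    simp
  · simp [transpose_sub, transpose_smul, transpose_vecMulVec]
  · rw [vecMul_sub, vecMul_one, vecMul_smul, vecMul_vecMulVec, hwu, smul_smul, inv_mul_cancel₀ hN]
    simp [u]

end Det

/-! ### Contraction along edges and the loss of one colour -/

section Contraction

variable {V E : Type*} {H : V → Type*} [Fintype V] [Fintype E] [DecidableEq E]
  [∀ v, Fintype (H v)] [∀ v, DecidableEq (H v)]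

/-- Contraction of tensors along the edges is invariant under orthogonal transformations. -/
theorem sum_prod_transform_eq {q : ℕ} (edge : ∀ v, H v → E) (Φ : E × Fin 2 ≃ Σ v, H v)
    (hΦ : ∀ p, edge (Φ p).1 (Φ p).2 = p.1) (U : Matrix (Fin q) (Fin q) ℝ)
    (hU : U.transpose * U = 1) (F : ∀ v, (H v → Fin q) → ℝ) :
    ∑ y : E → Fin q, ∏ v, ∑ d : H v → Fin q,
        (∏ h, U (y (edge v h)) (d h)) * F v d =
      ∑ y : E → Fin q, ∏ v, F v fun h => y (edge v h) := by
  classical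
  -- With `d` fixed, the sum over `y` factors over the edges, each factor being an entry of `Uᵀ * U
  -- = 1`.
  have key (d : ∀ v, H v → Fin q) :
      ∑ y : E → Fin q, ∏ v, ∏ h, U (y (edge v h)) (d v h) =
        ∏ e : E, if d _ (Φ (e, 0)).2 = d _ (Φ (e, 1)).2 then 1 else 0 := by
    have h1 (y : E → Fin q) : ∏ v, ∏ h, U (y (edge v h)) (d v h) =
        ∏ e : E, U (y e) (d _ (Φ (e, 0)).2) * U (y e) (d _ (Φ (e, 1)).2) := by
      rw [Finset.prod_sigma', Finset.univ_sigma_univ, ← Φ.prod_comp, Fintype.prod_prod_type]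
      simp [hΦ]
    simp only [h1]
    rw [← Fintype.prod_sum (fun (e : E) (c : Fin q) =>
      U c (d _ (Φ (e, 0)).2) * U c (d _ (Φ (e, 1)).2))]
    refine Finset.prod_congr rfl fun e _ => ?_
    have := congrFun (congrFun hU (d _ (Φ (e, 0)).2)) (d _ (Φ (e, 1)).2)
    simpa [Matrix.mul_apply, Matrix.one_apply] using this
  simp only [Fintype.prod_sum, Finset.prod_mul_distrib]
  rw [Finset.sum_comm]
  simp only [← Finset.sum_mul, key]
  symm
  -- The surviving `d` agree on the two halves of every edge, so they come from edge colourings.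
  refine Finset.sum_of_injOn (fun y v h => y (edge v h)) ?_ ?_ ?_ ?_
  · intro y _ y' _ h
    ext1 e
    have := congrFun (congrFun h (Φ (e, 0)).1) (Φ (e, 0)).2
    simpa [hΦ] using this
  · intro _ _; simp
  · intro d _ hd
    have : ∃ e, d _ (Φ (e, 0)).2 ≠ d _ (Φ (e, 1)).2 := by
      by_contra! hcon
      refine hd ⟨fun e => d _ (Φ (e, 0)).2, by simp, ?_⟩
      ext1 v
      ext1 h
      obtain ⟨⟨e, i⟩, hp⟩ := Φ.surjective ⟨v, h⟩
      have he := hΦ (e, i)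
      rw [hp] at he
      change edge v h = e at he
      subst he
      have : d _ (Φ (edge v h, i)).2 = d v h := by rw [hp]
      change d _ (Φ (edge v h, 0)).2 = d v h
      rw [← this]
      fin_cases i
      · rfl
      · exact hcon _
    obtain ⟨e, he⟩ := this
    rw [Finset.prod_eq_zero (Finset.mem_univ e) (by simp [he]), zero_mul]
  · intro y _
    simp [hΦ]

/-- The determinant identities, carried from `Fin k` to the half-edges at one vertex by the
increasing enumeration. -/
theorem sum_prod_mul_mapSign {k : ℕ} {X : Type*} [Fintype X] [DecidableEq X] (lX : LinearOrder X)
    (hX : Nat.card X = k) (U : Matrix (Fin (k + 1)) (Fin (k + 1)) ℝ) (hU : U * U = 1) {t : ℝ}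
    (hUw : Matrix.vecMul (altVec k) U = t • Pi.single 0 1) (c : X → Fin (k + 1)) :
    ∑ d : X → Fin (k + 1), (∏ x, U (c x) (d x)) * (mapSign lX inferInstance d : ℤ) =
      U.det * t * if ∀ x, c x ≠ 0 then ((mapSign lX inferInstance c : ℤ) : ℝ) else 0 := by
  obtain ⟨e, he⟩ := exists_equiv_fin_lt_iff lX hX
  have hF (d : Fin k → Fin (k + 1)) :
      mapSign lX inferInstance (d ∘ e) = mapSign inferInstance inferInstance d :=
    mapSign_comp_equiv lX inferInstance _ e he d
  obtain ⟨c, rfl⟩ : ∃ c', c = c' ∘ e := ⟨c ∘ e.symm, by ext; simp⟩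
  have h1 := sum_prod_mul_det_unitRows (altVec k) c U hU
  simp only [hUw, det_unitRows_altVec, det_unitRows_smul_single_zero] at h1
  rw [← (e.arrowCongr (Equiv.refl (Fin (k + 1)))).symm.sum_comp, hF, mul_assoc]
  have h2 : (∀ x, (c ∘ e) x ≠ 0) ↔ ∀ i, c i ≠ 0 := e.forall_congr_left.trans (by simp)
  simp only [h2]
  rw [← h1]
  refine Finset.sum_congr rfl fun d _ => ?_
  have h3 : (e.arrowCongr (Equiv.refl (Fin (k + 1)))).symm d = d ∘ e := by ext; simp
  rw [h3, hF, ← e.prod_comp]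
  rfl

/-- Reduction from `k + 1` to `k` colours for the signed number of edge colourings of a `k`-regular
graph, presented by its half-edges. -/
theorem exists_sum_prod_mapSign_eq {k : ℕ} (edge : ∀ v, H v → E) (Φ : E × Fin 2 ≃ Σ v, H v)
    (hΦ : ∀ p, edge (Φ p).1 (Φ p).2 = p.1) (hk : ∀ v, Nat.card (H v) = k) :
    ∃ δ : ℤˣ, ∀ o : ∀ v, LinearOrder (H v),
      ∑ y : E → Fin (k + 1), ∏ v, ((mapSign (o v) inferInstance fun h => y (edge v h) : ℤ) : ℝ) =
        (δ : ℤ) * √((k : ℝ) + 1) ^ Fintype.card V *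
          ∑ y : E → Fin k, ∏ v, ((mapSign (o v) inferInstance fun h => y (edge v h) : ℤ) : ℝ) := by
  obtain ⟨U, hUU, hUt, hUw⟩ := exists_reflection_altVec k
  obtain ⟨δ, hδ⟩ : ∃ δ : ℤˣ, U.det * -1 = ((δ : ℤ) : ℝ) := by
    have : U.det * U.det = 1 := by rw [← Matrix.det_mul, hUU, Matrix.det_one]
    rcases mul_self_eq_one_iff.1 this with h | h
    · exact ⟨-1, by simp [h]⟩
    · exact ⟨1, by simp [h]⟩
  refine ⟨δ ^ Fintype.card V, fun o => ?_⟩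
  rw [← sum_prod_transform_eq edge Φ hΦ U (by rw [hUt, hUU])
    (fun v d => ((mapSign (o v) inferInstance d : ℤ) : ℝ))]
  simp only [sum_prod_mul_mapSign (o _) (hk _) U hUU hUw, Finset.prod_mul_distrib,
    Finset.prod_const, Finset.card_univ]
  rw [← Finset.mul_sum]
  have h1 : (U.det * -√((k : ℝ) + 1)) = (δ : ℤ) * √((k : ℝ) + 1) := by rw [← hδ]; ring
  rw [← mul_pow, h1, mul_pow]
  push_cast
  congr 1
  symm
  -- Only colourings that never use `0` contribute, and these are the shifted `k`-colourings.
  refine Finset.sum_of_injOn (fun y e => (y e).succ) ?_ ?_ ?_ ?_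
  · intro y _ y' _ h
    ext1 e
    simpa using congrFun h e
  · intro _ _; simp
  · intro y _ hy
    obtain ⟨e, he⟩ : ∃ e, y e = 0 := by
      by_contra! hcon
      choose z hz using fun e => Fin.exists_succ_eq.2 (hcon e)
      exact hy ⟨z, by simp, funext hz⟩
    refine Finset.prod_eq_zero (Finset.mem_univ (Φ (e, 0)).1) (if_neg ?_)
    push Not
    exact ⟨(Φ (e, 0)).2, by rw [hΦ]; exact he⟩
  · intro y _
    refine Finset.prod_congr rfl fun v _ => ?_
    rw [if_pos fun h => Fin.succ_ne_zero _, ← mapSign_embedding_comp (o v) inferInstance inferInstance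
      (Fin.succ (n := k)) (Fin.succ_injective k) (fun a b => Fin.succ_lt_succ_iff)]
    rfl

end Contraction

/-! ### Colour classes as perfect matchings -/

section ColourClasses

variable {V E : Type*} {H : V → Type*} [Fintype V] [Fintype E] {k : ℕ}

/-- The colour classes of a proper edge `k`-colouring of a `k`-regular graph are perfect
matchings: `θ` lists the edges of each colour, and `a c` lists the ends of the edges coloured `c`. -/
theorem exists_colour_class_listing (edge : ∀ v, H v → E) (Φ : E × Fin 2 ≃ Σ v, H v)
    (hΦ : ∀ p, edge (Φ p).1 (Φ p).2 = p.1) (y : E → Fin k) (f : ∀ v, H v ≃ Fin k)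
    (hf : ∀ v h, f v h = y (edge v h)) :
    ∃ (θ : Fin k × Fin (Fintype.card V / 2) ≃ E)
      (a : Fin k → (Fin (Fintype.card V / 2) × Fin 2 ≃ V)),
      (∀ c i, y (θ (c, i)) = c) ∧ ∀ c i j, a c (i, j) = (Φ (θ (c, i), j)).1 := by
  classical
  let b (c : Fin k) : {e // y e = c} × Fin 2 → V := fun p => (Φ (p.1, p.2)).1
  -- Each vertex has exactly one half-edge of colour `c`, because `f v` is a bijection.
  have hb (c : Fin k) : Function.Bijective (b c) := by
    constructor
    · rintro ⟨⟨e, he⟩, i⟩ ⟨⟨e', he'⟩, i'⟩ h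
      change (Φ (e, i)).1 = (Φ (e', i')).1 at h
      have key : ∀ (s t : Σ v, H v), s.1 = t.1 → y (edge s.1 s.2) = y (edge t.1 t.2) → s = t := by
        rintro ⟨v, g⟩ ⟨v', g'⟩ h1 h2
        obtain rfl : v = v' := h1
        rw [← hf, ← hf] at h2
        exact congrArg (Sigma.mk v) ((f v).injective h2)
      have := Φ.injective (key _ _ h (by rw [hΦ, hΦ, he, he']))
      simp only [Prod.mk.injEq] at this
      obtain ⟨rfl, rfl⟩ := this
      rfl
    · intro v
      obtain ⟨⟨e, i⟩, hp⟩ := Φ.surjective ⟨v, (f v).symm c⟩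
      have he := hΦ (e, i)
      rw [hp] at he
      have hc : y e = c := by 
        change edge v _ = e at he
        rw [← he, ← hf, Equiv.apply_symm_apply]
      exact ⟨(⟨e, hc⟩, i), by simp [b, hp]⟩
  -- The division is exact as soon as some colour `c` exists; for `k = 0` nothing is claimed.
  have hcard (c : Fin k) : Fintype.card {e // y e = c} = Fintype.card V / 2 := by
    rw [← Fintype.card_of_bijective (hb c), Fintype.card_prod, Fintype.card_fin]
    omega
  let t (c : Fin k) : Fin (Fintype.card V / 2) ≃ {e // y e = c} :=
    (Fintype.equivFinOfCardEq (hcard c)).symm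
  refine ⟨(Equiv.sigmaEquivProd _ _).symm.trans
    ((Equiv.sigmaCongrRight t).trans (Equiv.sigmaFiberEquiv y)),
    fun c => ((t c).prodCongr (Equiv.refl _)).trans (Equiv.ofBijective _ (hb c)), ?_, ?_⟩
  · intro c i
    exact (t c i).2
  · intro c i j
    rfl

/-- The signs of two proper edge colourings differ by the signs of their colour classes. -/
theorem prod_sign_vertex_eq_prod_sign_colour [DecidableEq V] {m : ℕ} (edge : ∀ v, H v → E)
    (Φ : E × Fin 2 ≃ Σ v, H v) (hΦ : ∀ p, edge (Φ p).1 (Φ p).2 = p.1) (y y' : E → Fin k)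
    (f f' : ∀ v, H v ≃ Fin k) (hf : ∀ v h, f v h = y (edge v h))
    (hf' : ∀ v h, f' v h = y' (edge v h))
    (θ θ' : Fin k × Fin m ≃ E) (a a' : Fin k → (Fin m × Fin 2 ≃ V))
    (hθ : ∀ c i, y (θ (c, i)) = c) (hθ' : ∀ c i, y' (θ' (c, i)) = c)
    (ha : ∀ c i j, a c (i, j) = (Φ (θ (c, i), j)).1)
    (ha' : ∀ c i j, a' c (i, j) = (Φ (θ' (c, i), j)).1) :
    ∏ v, Equiv.Perm.sign ((f v).symm.trans (f' v)) =
      ∏ c, Equiv.Perm.sign ((a c).symm.trans (a' c)) := by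
  classical
  -- Both colourings identify half-edges with pairs (vertex, colour). `Q` passes from one to the
  -- other fixing vertices. `P` fixes colours, and differs from `Q` only by a conjugate of `R`,
  -- which moves whole edges.
  let ψ : E × Fin 2 ≃ V × Fin k :=
    (Φ.trans (Equiv.sigmaCongrRight f)).trans (Equiv.sigmaEquivProd _ _)
  let ψ' : E × Fin 2 ≃ V × Fin k :=
    (Φ.trans (Equiv.sigmaCongrRight f')).trans (Equiv.sigmaEquivProd _ _)
  have hψ (p) : ψ p = ((Φ p).1, y p.1) := by
    exact Prod.ext rfl ((hf _ _).trans (congrArg y (hΦ p)))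
  have hψ' (p) : ψ' p = ((Φ p).1, y' p.1) := by
    exact Prod.ext rfl ((hf' _ _).trans (congrArg y' (hΦ p)))
  let Q : Equiv.Perm (V × Fin k) := Equiv.prodCongrRight fun v => (f v).symm.trans (f' v)
  let P : Equiv.Perm (V × Fin k) := Equiv.prodCongrLeft fun c => (a c).symm.trans (a' c)
  let ρ : Equiv.Perm E := θ.symm.trans θ'
  let R : Equiv.Perm (E × Fin 2) := Equiv.prodCongrLeft fun _ => ρ
  have h1 : ψ' = ψ.trans Q := by
    ext1 p
    obtain ⟨⟨v, h⟩, rfl⟩ := Φ.symm.surjective p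
    simp [ψ, ψ', Q]
  have h2 : R.trans ψ' = ψ.trans P := by
    ext1 ⟨e, j⟩
    obtain ⟨⟨c, i⟩, rfl⟩ := θ.surjective e
    simp [R, ρ, hψ, hψ', P, hθ, hθ', ← ha, ← ha']
  have h3 : P = (ψ.symm.trans (R.trans ψ)).trans Q := by
    rw [Equiv.trans_assoc, Equiv.trans_assoc, ← h1, h2, ← Equiv.trans_assoc,
      Equiv.symm_trans_self, Equiv.refl_trans]
  -- `R` acts as `ρ` on each of the two halves, so its sign is a square.
  have hR : Equiv.Perm.sign R = 1 := by
    rw [Equiv.Perm.sign_prodCongrLeft]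
    simp
  have hQ : Equiv.Perm.sign Q = Equiv.Perm.sign P := by
    rw [h3, Equiv.Perm.sign_trans, ← Equiv.trans_assoc, Equiv.Perm.sign_symm_trans_trans, hR,
      mul_one]
  rwa [Equiv.Perm.sign_prodCongrRight, Equiv.Perm.sign_prodCongrLeft] at hQ

end ColourClasses

/-- A product of labels that record signs records the product of these signs. -/
theorem prod_ite_units_eq {ι Γ : Type*} [CommGroup Γ] {g : Γ} (hg : g * g = 1) (s : Finset ι)
    (t : ι → ℤˣ) :
    ∏ i ∈ s, (if t i = 1 then 1 else g) = if ∏ i ∈ s, t i = 1 then 1 else g := by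
  classical
  induction s using Finset.induction_on with
  | empty => simp
  | insert i s hi ih =>
    rw [Finset.prod_insert hi, Finset.prod_insert hi, ih]
    rcases Int.units_eq_one_or (t i) with h | h <;>
      rcases Int.units_eq_one_or (∏ i ∈ s, t i) with h' | h' <;> simp [h, h', hg]

/-! ### Half-edges, proper colourings and Pfaffian labellings -/

namespace Graph

variable {α : Type u} {β : Type v} {G : Graph α β}

instance [Finite E(G)] (v : V(G)) : Finite (G.HalfEdgesAt v) :=
  inferInstanceAs (Finite ({e : E(G) // G.Inc e v} ⊕ {e : E(G) // G.IsLoopAt e v}))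

/-- The two half-edges of every edge, that at the smaller end first. -/
theorem exists_halfEdge_equiv (lV : LinearOrder V(G)) :
    ∃ Φ : E(G) × Fin 2 ≃ Σ v : V(G), G.HalfEdgesAt v, (∀ p, (Φ p).2.edge = p.1) ∧
      ∀ e : E(G), G.IsLink e (Φ (e, 0)).1 (Φ (e, 1)).1 ∧ lV.le (Φ (e, 0)).1 (Φ (e, 1)).1 := by
  classical
  have hex (e : E(G)) : ∃ x y : V(G), G.IsLink e x y ∧ lV.le x y := by
    obtain ⟨x, y, h⟩ := G.exists_isLink_of_mem_edgeSet e.2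
    rcases lV.le_total ⟨x, h.left_mem⟩ ⟨y, h.right_mem⟩ with hl | hl
    · exact ⟨_, _, h, hl⟩
    · exact ⟨_, _, h.symm, hl⟩
  choose x y hxy hle using hex
  -- The second half of a loop must be the extra `Sum.inr` copy, as the first half already takes the
  -- `Sum.inl` one.
  let s (e : E(G)) : Σ v : V(G), G.HalfEdgesAt v :=
    if h : G.IsLoopAt e (y e) then ⟨y e, Sum.inr ⟨e, h⟩⟩
    else ⟨y e, Sum.inl ⟨e, (hxy e).inc_right⟩⟩
  have hs1 (e : E(G)) : (s e).1 = y e := by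
    simp only [s]; split_ifs <;> rfl
  have hs2 (e : E(G)) : (s e).2.edge = e := by
    by_cases h : G.IsLoopAt e (y e)
    · rw [show s e = ⟨y e, Sum.inr ⟨e, h⟩⟩ from dif_pos h]; rfl
    · rw [show s e = ⟨y e, Sum.inl ⟨e, (hxy e).inc_right⟩⟩ from dif_neg h]; rfl
  let φ (p : E(G) × Fin 2) : Σ v : V(G), G.HalfEdgesAt v :=
    ![⟨x p.1, Sum.inl ⟨p.1, (hxy p.1).inc_left⟩⟩, s p.1] p.2
  have hφe (p) : (φ p).2.edge = p.1 := by
    obtain ⟨e, i⟩ := p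
    fin_cases i
    · rfl
    · exact hs2 e
  have hne (e : E(G)) : φ (e, 0) ≠ φ (e, 1) := by
    intro h
    change (⟨x e, Sum.inl ⟨e, (hxy e).inc_left⟩⟩ : Σ v : V(G), G.HalfEdgesAt v) = s e at h
    have h1 : x e = y e := by rw [← hs1 e, ← h]
    have hl : G.IsLoopAt e (y e) := by have := hxy e; rwa [h1] at this
    simp only [s, dif_pos hl] at h
    have key : ∀ (v w : V(G)) (hv : G.Inc e v) (hw : G.IsLoopAt e w), v = w →
        (⟨v, Sum.inl ⟨e, hv⟩⟩ : Σ v : V(G), G.HalfEdgesAt v) ≠ ⟨w, Sum.inr ⟨e, hw⟩⟩ := by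
      rintro v _ hv hw rfl h
      exact Sum.inl_ne_inr (eq_of_heq (Sigma.mk.inj h).2)
    exact key _ _ _ _ h1 h
  have hbij : Function.Bijective φ := by
    constructor
    · rintro ⟨e, i⟩ ⟨e', i'⟩ h
      obtain rfl : e = e' := by
        have h1 := hφe (e, i)
        rw [h] at h1
        exact h1.symm.trans (hφe (e', i'))
      fin_cases i <;> fin_cases i'
      · rfl
      · exact absurd h (hne e)
      · exact absurd h.symm (hne e)
      · rfl
    · rintro ⟨v, ⟨e, he⟩ | ⟨e, he⟩⟩
      · by_cases hv : v = x e
        · subst hv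
          exact ⟨(e, 0), rfl⟩
        · have hv' : v = y e := by
            rcases he.eq_or_eq_of_isLink (hxy e) with h | h
            · exact absurd (Subtype.ext h) hv
            · exact Subtype.ext h
          subst hv'
          have hl : ¬ G.IsLoopAt e (y e) := fun hl =>
            hv (Subtype.ext (hl.eq_of_inc (hxy e).inc_left))
          refine ⟨(e, 1), ?_⟩
          change s e = _
          simp only [s, dif_neg hl]
      · obtain rfl : v = y e := Subtype.ext (he.eq_of_inc (hxy e).inc_right)
        refine ⟨(e, 1), ?_⟩
        change s e = _
        simp only [s, dif_pos he]
  refine ⟨Equiv.ofBijective φ hbij, hφe, fun e => ?_⟩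
  have h1 : ((φ (e, 1)).1 : V(G)) = y e := hs1 e
  constructor
  · change G.IsLink e (x e) (φ (e, 1)).1
    rw [h1]
    exact hxy e
  · change lV.le (x e) (φ (e, 1)).1
    rw [h1]
    exact hle e

theorem injective_of_forall_lineAdj_ne {γ : Type*} {y : E(G) → γ}
    (hy : ∀ e f, G.LineAdj e f → y e ≠ y f) (v : V(G)) :
    Function.Injective fun h : G.HalfEdgesAt v => y h.edge := by
  have hlink (h : G.HalfEdgesAt v) : G.Inc h.edge v := by
    rcases h with ⟨e, he⟩ | ⟨e, he⟩
    exacts [he, he.inc]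
  have hloop (e : E(G)) : ¬ G.IsLoopAt e v := fun h => hy e e (Or.inr ⟨rfl, v, h⟩) rfl
  intro h h' heq
  have he : h.edge = h'.edge := by
    by_contra hne
    exact hy _ _ (Or.inl ⟨hne, v, hlink h, hlink h'⟩) heq
  rcases h with ⟨e, _⟩ | ⟨e, hl⟩
  · rcases h' with ⟨e', _⟩ | ⟨e', hl⟩
    · obtain rfl : e = e' := he
      rfl
    · exact absurd hl (hloop e')
  · exact absurd hl (hloop e)

theorem lineAdj_ne_of_forall_injective {γ : Type*} {y : E(G) → γ}
    (hy : ∀ v : V(G), Function.Injective fun h : G.HalfEdgesAt v => y h.edge) (e f : E(G))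
    (h : G.LineAdj e f) : y e ≠ y f := by
  intro heq
  rcases h with ⟨hne, v, he, hf⟩ | ⟨rfl, v, hl⟩
  · have := @hy v (Sum.inl ⟨e, he⟩) (Sum.inl ⟨f, hf⟩) heq
    exact hne (congrArg Subtype.val (Sum.inl_injective this))
  · have := @hy v (Sum.inl ⟨e, hl.inc⟩) (Sum.inr ⟨e, hl⟩) rfl
    exact Sum.inl_ne_inr this

theorem colouringSign_eq_zero [Fintype V(G)] (o : G.HalfEdgeOrders) {q : ℕ} {y : E(G) → Fin q}
    (hy : ¬ ∀ e f, G.LineAdj e f → y e ≠ y f) : G.colouringSign o y = 0 := by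
  obtain ⟨v, hv⟩ : ∃ v : V(G), ¬ Function.Injective fun h : G.HalfEdgesAt v => y h.edge := by
    by_contra! hcon
    exact hy (lineAdj_ne_of_forall_injective hcon)
  exact Finset.prod_eq_zero (Finset.mem_univ v) (mapSign_of_not_injective _ _ hv)

theorem exists_equiv_of_proper [Finite E(G)] {k : ℕ} (hreg : G.IsRegularGraph k) {y : E(G) → Fin k}
    (hy : ∀ e f, G.LineAdj e f → y e ≠ y f) :
    ∃ f : ∀ v : V(G), G.HalfEdgesAt v ≃ Fin k, ∀ v h, f v h = y h.edge := by
  have hb (v : V(G)) : Function.Bijective fun h : G.HalfEdgesAt v => y h.edge := by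
    have := Fintype.ofFinite (G.HalfEdgesAt v)
    rw [Fintype.bijective_iff_injective_and_card]
    refine ⟨injective_of_forall_lineAdj_ne hy v, ?_⟩
    rw [← Nat.card_eq_fintype_card, hreg v, Fintype.card_fin]
  exact ⟨fun v => Equiv.ofBijective _ (hb v), fun _ _ => rfl⟩

theorem colouringSign_eq_ordersSign_mul [Fintype V(G)] [Finite E(G)]
    {k : ℕ} (hreg : G.IsRegularGraph k) {y : E(G) → Fin k}
    (hy : ∀ e f, G.LineAdj e f → y e ≠ y f) (o o' : G.HalfEdgeOrders) :
    G.colouringSign o y = G.ordersSign o o' * G.colouringSign o' y := by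
  obtain ⟨f, hf⟩ := exists_equiv_of_proper hreg hy
  unfold colouringSign ordersSign
  simp only [← hf]
  rw [← Finset.prod_mul_distrib]
  exact Finset.prod_congr rfl fun v _ =>
    mapSign_trans (o v) (o' v) inferInstance (Equiv.refl _) (f v)

theorem exists_units_ordersSign_eq [Fintype V(G)] [Finite E(G)]
    (o o' : G.HalfEdgeOrders) :
    ∃ s : ℤˣ, G.ordersSign o o' = s := by
  choose s hs using fun v => exists_units_mapSign_eq (o v) (o' v) (Equiv.refl _)
  exact ⟨∏ v, s v, by rw [Units.coe_prod]; exact Finset.prod_congr rfl fun v _ => hs v⟩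

theorem exists_units_colouringSign_eq [Fintype V(G)] [Finite E(G)]
    {k : ℕ} (hreg : G.IsRegularGraph k) {y : E(G) → Fin k}
    (hy : ∀ e f, G.LineAdj e f → y e ≠ y f) (o : G.HalfEdgeOrders) :
    ∃ s : ℤˣ, G.colouringSign o y = s := by
  obtain ⟨f, hf⟩ := exists_equiv_of_proper hreg hy
  choose s hs using fun v => exists_units_mapSign_eq (o v) inferInstance (f v)
  refine ⟨∏ v, s v, ?_⟩
  rw [Units.coe_prod]
  unfold colouringSign
  simp only [← hf]
  exact Finset.prod_congr rfl fun v _ => hs v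

theorem ordersSign_trans [Fintype V(G)] [Finite E(G)]
    (o o' o'' : G.HalfEdgeOrders) :
    G.ordersSign o o'' = G.ordersSign o o' * G.ordersSign o' o'' := by
  unfold ordersSign
  rw [← Finset.prod_mul_distrib]
  exact Finset.prod_congr rfl fun v _ =>
    mapSign_trans (o v) (o' v) (o'' v) (Equiv.refl _) (Equiv.refl _)

theorem ordersSign_comm [Fintype V(G)] [Finite E(G)]
    (o o' : G.HalfEdgeOrders) : G.ordersSign o o' = G.ordersSign o' o := by
  have h1 : G.ordersSign o o' * G.ordersSign o' o = 1 := by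
    rw [← ordersSign_trans]
    refine Finset.prod_eq_one fun v _ => ?_
    classical
    have := Fintype.ofFinite (G.HalfEdgesAt v)
    simpa using mapSign_perm (o v) (Equiv.refl _)
  obtain ⟨s, hs⟩ := exists_units_ordersSign_eq o o'
  obtain ⟨t, ht⟩ := exists_units_ordersSign_eq o' o
  rw [hs, ht] at h1 ⊢
  have h2 : s * t = 1 := Units.ext h1
  rw [eq_inv_of_mul_eq_one_left h2, Int.units_inv_eq_self]

/-- The perfect matching that lists the edges `t i`, whose ends are listed by `a`. -/
def PerfectMatching.ofEquiv {lV : LinearOrder V(G)} {n : ℕ} (t : Fin n → E(G))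
    (a : Fin n × Fin 2 ≃ V(G)) (hlink : ∀ i, G.IsLink (t i) (a (i, 0)) (a (i, 1)))
    (hle : ∀ i, lV.le (a (i, 0)) (a (i, 1))) : G.PerfectMatching lV n where
  edge := t
  fst i := a (i, 0)
  snd i := a (i, 1)
  isLink := hlink
  lt i := lt_of_le_of_ne (hle i) fun h => by simpa using a.injective h
  covers w := by
    obtain ⟨⟨i, j⟩, rfl⟩ := a.surjective w
    refine ⟨i, ?_, ?_⟩
    · fin_cases j <;> simp
    · rintro i' (h | h)
      · exact (congrArg Prod.fst (a.injective h)).symm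
      · exact (congrArg Prod.fst (a.injective h)).symm

theorem PerfectMatching.sign_ofEquiv {lV : LinearOrder V(G)} {n : ℕ} (t : Fin n → E(G))
    (a : Fin n × Fin 2 ≃ V(G)) (hlink : ∀ i, G.IsLink (t i) (a (i, 0)) (a (i, 1)))
    (hle : ∀ i, lV.le (a (i, 0)) (a (i, 1))) :
    (PerfectMatching.ofEquiv t a hlink hle).sign =
      mapSign (X := Fin n ×ₗ Fin 2) inferInstance lV (ofLex.trans a) := by
  unfold PerfectMatching.sign
  congr 1
  ext1 p
  obtain ⟨⟨i, j⟩, rfl⟩ := toLex.surjective p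
  fin_cases j <;> rfl

/-- The product of all labels does not depend on the colouring, yet it records the product of the
signs of the colour classes, legibly because `negOne ≠ 1`. -/
theorem IsPfaffianLabelling.colouringSign_eq [Fintype V(G)] [Finite E(G)] {k : ℕ}
    (hreg : G.IsRegularGraph k)
    {lV : LinearOrder V(G)} {Γ : Type w} [CommGroup Γ] {negOne : Γ} {l : E(G) → Γ}
    (hneg : orderOf negOne = 2) (hl : G.IsPfaffianLabelling lV negOne l)
    (o : G.HalfEdgeOrders) {y y' : E(G) → Fin k}
    (hy : ∀ e f, G.LineAdj e f → y e ≠ y f) (hy' : ∀ e f, G.LineAdj e f → y' e ≠ y' f) :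
    G.colouringSign o y = G.colouringSign o y' := by
  classical
  have := Fintype.ofFinite E(G)
  obtain ⟨Φ, hΦ, hlink⟩ := exists_halfEdge_equiv lV
  obtain ⟨f, hf⟩ := exists_equiv_of_proper hreg hy
  obtain ⟨f', hf'⟩ := exists_equiv_of_proper hreg hy'
  obtain ⟨θ, a, hθ, ha⟩ :=
    exists_colour_class_listing (fun _ h => HalfEdgesAt.edge h) Φ hΦ y f hf
  obtain ⟨θ', a', hθ', ha'⟩ :=
    exists_colour_class_listing (fun _ h => HalfEdgesAt.edge h) Φ hΦ y' f' hf'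
  have hprod := prod_sign_vertex_eq_prod_sign_colour (fun _ h => HalfEdgesAt.edge h) Φ hΦ y y'
    f f' hf hf' θ θ' a a' hθ hθ' ha ha'
  have hsq : negOne * negOne = 1 := by
    rw [← pow_two, ← hneg, pow_orderOf_eq_one]
  have hne : negOne ≠ 1 := by
    intro h
    rw [h, orderOf_one] at hneg
    omega
  have labels (θ : Fin k × Fin (Fintype.card V(G) / 2) ≃ E(G))
      (a : Fin k → (Fin (Fintype.card V(G) / 2) × Fin 2 ≃ V(G)))
      (ha : ∀ c i j, a c (i, j) = (Φ (θ (c, i), j)).1) (s : Fin k → ℤˣ)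
      (hs : ∀ c, mapSign (X := Fin (Fintype.card V(G) / 2) ×ₗ Fin 2) inferInstance lV
        (ofLex.trans (a c)) = s c) :
      ∏ e, l e = if ∏ c, s c = 1 then 1 else negOne := by
    rw [← prod_ite_units_eq hsq, ← θ.prod_comp, Fintype.prod_prod_type]
    refine Finset.prod_congr rfl fun c _ => ?_
    have h1 := hl _ (PerfectMatching.ofEquiv (lV := lV) (fun i => θ (c, i)) (a c)
      (fun i => by rw [ha, ha]; exact (hlink _).1) (fun i => by rw [ha, ha]; exact (hlink _).2))
    rw [PerfectMatching.sign_ofEquiv, hs] at h1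
    refine h1.trans ?_
    simp only [Units.val_eq_one]
  choose s hs using fun c => exists_units_mapSign_eq
    (X := Fin (Fintype.card V(G) / 2) ×ₗ Fin 2) inferInstance lV (ofLex.trans (a c))
  choose s' hs' using fun c => exists_units_mapSign_eq
    (X := Fin (Fintype.card V(G) / 2) ×ₗ Fin 2) inferInstance lV (ofLex.trans (a' c))
  have hss : ∏ c, s c = ∏ c, s' c := by
    have h := (labels θ a ha s hs).symm.trans (labels θ' a' ha' s' hs')
    generalize ∏ c, s c = σ at h
    generalize ∏ c, s' c = τ at h
    clear hs hs'
    rcases Int.units_eq_one_or σ with rfl | rfl <;>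
      rcases Int.units_eq_one_or τ with rfl | rfl
    · rfl
    · exact absurd h.symm (by simpa using hne)
    · exact absurd h (by simpa using hne)
    · rfl
  have hcs (c : Fin k) : s' c = s c * Equiv.Perm.sign ((a c).symm.trans (a' c)) := by
    have := mapSign_eq_mul_sign (X := Fin (Fintype.card V(G) / 2) ×ₗ Fin 2) inferInstance lV
      (ofLex.trans (a c)) (ofLex.trans (a' c))
    rw [hs, hs'] at this
    exact_mod_cast this
  have hone : ∏ c, Equiv.Perm.sign ((a c).symm.trans (a' c)) = 1 := by
    simp only [hcs, Finset.prod_mul_distrib] at hss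
    exact (mul_eq_left.1 hss.symm)
  rw [hone] at hprod
  unfold colouringSign
  simp only [← hf, ← hf']
  have hv (v : V(G)) := mapSign_eq_mul_sign (o v) inferInstance (f v) (f' v)
  symm
  refine (Finset.prod_congr rfl fun v _ => hv v).trans ?_
  rw [Finset.prod_mul_distrib, ← Units.coe_prod, hprod, Units.val_one, mul_one]

end Graph

/-! ### The main theorem -/

theorem theorem4p11 {α : Type u} {β : Type v} (G : Graph α β)
    [Fintype V(G)] [Fintype E(G)] [DecidableEq E(G)] (k : ℕ)
    (hreg : G.IsRegularGraph k)
    (hpf : Graph.AdmitsPfaffianLabelling.{u, v, w} G) :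
    ∃ ε : G.HalfEdgeOrders → ℤˣ,
      (∀ o o' : G.HalfEdgeOrders, ((ε o' : ℤˣ) : ℤ) = G.ordersSign o o' * ((ε o : ℤˣ) : ℤ)) ∧
      ∀ o : G.HalfEdgeOrders,
        (((ε o : ℤˣ) : ℤ) : ℝ) * (G.numProperEdgeColourings k : ℝ) =
          ((k : ℝ) + 1) ^ (-(Fintype.card V(G) : ℝ) / 2) *
            ∑ y : E(G) → Fin (k + 1), ((G.colouringSign o y : ℤ) : ℝ) := by
  classical
  obtain ⟨Γ, _, negOne, lV, l, hneg, hl⟩ := hpf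
  have (v : V(G)) : Fintype (G.HalfEdgesAt v) := Fintype.ofFinite _
  obtain ⟨Φ, hΦ, -⟩ := Graph.exists_halfEdge_equiv lV
  obtain ⟨δ, hδ⟩ := exists_sum_prod_mapSign_eq (fun _ h => Graph.HalfEdgesAt.edge h) Φ hΦ hreg
  have hsum (o : G.HalfEdgeOrders) :
      ((k : ℝ) + 1) ^ (-(Fintype.card V(G) : ℝ) / 2) *
        ∑ y : E(G) → Fin (k + 1), ((G.colouringSign o y : ℤ) : ℝ) =
      (δ : ℤ) * ∑ y : E(G) → Fin k, ((G.colouringSign o y : ℤ) : ℝ) := by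
    have h := hδ o
    simp only [← Int.cast_prod] at h
    change ∑ y : E(G) → Fin (k + 1), ((G.colouringSign o y : ℤ) : ℝ) = _ at h
    rw [h, ← mul_assoc, mul_left_comm, ← mul_assoc, mul_assoc ((δ : ℤ) : ℝ)]
    have h0 : (0 : ℝ) < (k : ℝ) + 1 := by positivity
    rw [Real.sqrt_eq_rpow, ← Real.rpow_mul_natCast h0.le, ← Real.rpow_add h0]
    rw [show -(Fintype.card V(G) : ℝ) / 2 + 1 / 2 * (Fintype.card V(G) : ℝ) = 0 by ring,
      Real.rpow_zero, mul_one]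
    rfl
  -- An arbitrary reference system of orders; `η` is the common sign of proper colourings with
  -- respect to it.
  let o₀ : G.HalfEdgeOrders := fun v => IsWellOrder.linearOrder WellOrderingRel
  obtain ⟨η, hη⟩ : ∃ η : ℤˣ, ∀ y : E(G) → Fin k, (∀ e f, G.LineAdj e f → y e ≠ y f) →
      G.colouringSign o₀ y = η := by
    by_cases hex : ∃ y : E(G) → Fin k, ∀ e f, G.LineAdj e f → y e ≠ y f
    · obtain ⟨y₀, hy₀⟩ := hex
      obtain ⟨η, hη⟩ := Graph.exists_units_colouringSign_eq hreg hy₀ o₀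
      exact ⟨η, fun y hy => (hl.colouringSign_eq hreg hneg o₀ hy hy₀).trans hη⟩
    · push Not at hex
      -- Without proper colourings any unit serves.
      refine ⟨1, fun y hy => ?_⟩
      obtain ⟨e, f, hef, h⟩ := hex y
      exact absurd h (hy e f hef)
  choose s hs using fun o => Graph.exists_units_ordersSign_eq o₀ o
  -- `s o` transports the common sign from `o₀` to `o` and gives the parity rule; `δ` comes from the
  -- reflection.
  refine ⟨fun o => s o * (δ * η), fun o o' => ?_, fun o => ?_⟩
  · push_cast
    rw [← hs, ← hs, Graph.ordersSign_comm o o', Graph.ordersSign_comm o₀ o',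
      Graph.ordersSign_comm o₀ o, Graph.ordersSign_trans o' o o₀, mul_assoc]
  · rw [hsum]
    have hy (y : E(G) → Fin k) : ((G.colouringSign o y : ℤ) : ℝ) =
        if ∀ e f, G.LineAdj e f → y e ≠ y f then (((s o * η : ℤˣ) : ℤ) : ℝ) else 0 := by
      split_ifs with h
      · rw [Graph.colouringSign_eq_ordersSign_mul hreg h o o₀, hη y h, Graph.ordersSign_comm, hs,
          Units.val_mul]
      · rw [Graph.colouringSign_eq_zero o h, Int.cast_zero]
    simp only [hy]
    rw [Finset.sum_ite, Finset.sum_const_zero, add_zero, Finset.sum_const, nsmul_eq_mul,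
      Graph.numProperEdgeColourings, Nat.card_eq_fintype_card, Fintype.card_subtype]
    push_cast
    ring
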